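/- Let $U$ be a $2\times 2$ unitary matrix with rows and columns indexed by the internal states $|R\rangle,|L\rangle$, and let $b=\langle R|U|L\rangle$ be its upper right entry; for example $U=\begin{bmatrix} a & b\\ -\bar b & \bar a\end{bmatrix}$ with $|a|^2+|b|^2=1$. Assume $|b|<1$. On $\ell^2(\mathbb Z\times\{R,L\})$ let $Q=T(I\otimes U)$, where $T|x\rangle|R\rangle=|x+1\rangle|R\rangle$ and $T|x\rangle|L\rangle=|x-1\rangle|L\rangle$, and let $\Pi_n$ be the orthogonal projection onto the closed span of the basis vectors $|x\rangle|\sigma\rangle$ with $x\notin\{0,n\}$. For integers $0<m<n$ let $$P_n^{(m)}(1,0)=\sum_{t=1}^{\infty}\ \sum_{\sigma\in\{R,L\}}\bigl|\langle 0,\sigma|\,Q(\Pi_n Q)^{t-1}\,|m,R\rangle\bigr|^2$$ be the probability that the quantum walk particle started in $|m\rangle|R\rangle$ is eventually absorbed at $|0\rangle$ before being absorbed at $|n\rangle$. Then: 1. For every integer $m\ge 1$, $$\lim_{n\to\infty}P_n^{(m)}(1,0)=\frac{|b|}{2}\left[1+\left(\frac{1-|b|}{1+|b|}\right)^{m-1}\right].$$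 2. For every $0<c<1$, the limit along the ray $m=cn$ is $|b|/2$: if $n_k,m_k$ are natural numbers with $n_k\to\infty$ and $m_k/n_k\to c$ (for instance $m_k=cn_k$ whenever this is an integer, or $m_k=\lfloor cn_k\rfloor$), then $$\lim_{k\to\infty}P_{n_k}^{(m_k)}(1,0)=\frac{|b|}{2}.$$ -/

import Mathlib

open Filter Topology
open scoped ENNReal lp

namespace QuantumWalk

noncomputable section

section General

variable {G : Type*} [AddGroup G] [DecidableEq G] {S : Finset G}

/-- The Hilbert space `ℓ²(G × Σ)`, for a finite set `Σ = S` of directions in the group `G`. -/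
abbrev State (S : Finset G) : Type _ := ℓ²(G × S, ℂ)

/-- The orthonormal basis vector `|g⟩|σ⟩`, for `x = (g, σ)`. -/
def ket (x : G × S) : State S := lp.single 2 x (1 : ℂ)

theorem memℓp_shift (ψ : State S) :
    Memℓp (fun x : G × S => ψ (-(x.2 : G) + x.1, x.2)) 2 := by
  have hinj : Function.Injective (fun x : G × S => ((-(x.2 : G) + x.1, x.2) : G × S)) := by
    rintro ⟨g, s⟩ ⟨h, t⟩ hx
    simp only [Prod.mk.injEq] at hx
    obtain ⟨h1, rfl⟩ := hx
    simpa using h1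
  have h := lp.memℓp ψ
  rw [memℓp_gen_iff (by norm_num)] at h ⊢
  exact h.comp_injective hinj

theorem memℓp_coin (U : Matrix.unitaryGroup S ℂ) (ψ : State S) :
    Memℓp (fun x : G × S => ∑ s : S, (U : Matrix S S ℂ) x.2 s * ψ (x.1, s)) 2 := by
  have hsum : ∀ t : S, Summable fun g : G => ‖ψ (g, t)‖ ^ (2 : ℝ≥0∞).toReal := by
    intro t
    have h := lp.memℓp ψ
    rw [memℓp_gen_iff (by norm_num)] at h
    exact h.comp_injective (i := fun g : G => ((g, t) : G × S))
      (fun g h hgh => (Prod.mk.inj hgh).1)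
  refine Memℓp.finsetSum Finset.univ
    (f := fun (s : S) (x : G × S) => (U : Matrix S S ℂ) x.2 s * ψ (x.1, s)) fun t _ => ?_
  rw [memℓp_gen_iff (by norm_num)]
  have hprod : Summable fun x : G × S =>
      ‖ψ (x.1, t)‖ ^ (2 : ℝ≥0∞).toReal *
        ‖(U : Matrix S S ℂ) x.2 t‖ ^ (2 : ℝ≥0∞).toReal := by
    refine Summable.mul_of_nonneg (f := fun g : G => ‖ψ (g, t)‖ ^ (2 : ℝ≥0∞).toReal)
      (g := fun s : S => ‖(U : Matrix S S ℂ) s t‖ ^ (2 : ℝ≥0∞).toReal)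
      (hsum t) (Summable.of_finite) ?_ ?_
    · intro g; exact Real.rpow_nonneg (norm_nonneg _) _
    · intro s; exact Real.rpow_nonneg (norm_nonneg _) _
  refine hprod.congr fun x => ?_
  rw [norm_mul, Real.mul_rpow (norm_nonneg _) (norm_nonneg _), mul_comm]

theorem memℓp_projNo (B : Set (G × S)) (ψ : State S) :
    Memℓp (Bᶜ.indicator fun x : G × S => ψ x) 2 := by
  have h := lp.memℓp ψ
  rw [memℓp_gen_iff (by norm_num)] at h ⊢
  refine Summable.of_nonneg_of_le (fun _ => Real.rpow_nonneg (norm_nonneg _) _)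
    (fun x => ?_) h
  exact Real.rpow_le_rpow (norm_nonneg _) (norm_indicator_le_norm_self _ _)
    ENNReal.toReal_nonneg

/-- The shift `T : |g⟩|σ⟩ ↦ |σ + g⟩|σ⟩` of `ℓ²(G × Σ)`. -/
def shift (S : Finset G) : State S →ₗ[ℂ] State S where
  toFun ψ := ⟨fun x => ψ (-(x.2 : G) + x.1, x.2), memℓp_shift ψ⟩
  map_add' _ _ := rfl
  map_smul' _ _ := rfl

/-- The coin operator `I ⊗ U` on `ℓ²(G × Σ)`: `|g⟩|σ⟩ ↦ ∑ τ, U τ σ |g⟩|τ⟩`. -/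
def coin (U : Matrix.unitaryGroup S ℂ) : State S →ₗ[ℂ] State S where
  toFun ψ := ⟨fun x => ∑ s : S, (U : Matrix S S ℂ) x.2 s * ψ (x.1, s), memℓp_coin U ψ⟩
  map_add' φ ψ := by
    ext x
    change ∑ s : S, (U : Matrix S S ℂ) x.2 s * (φ (x.1, s) + ψ (x.1, s)) =
      ∑ s : S, (U : Matrix S S ℂ) x.2 s * φ (x.1, s) +
        ∑ s : S, (U : Matrix S S ℂ) x.2 s * ψ (x.1, s)
    simp only [mul_add, Finset.sum_add_distrib]
  map_smul' c ψ := by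
    ext x
    change ∑ s : S, (U : Matrix S S ℂ) x.2 s * (c * ψ (x.1, s)) =
      c * ∑ s : S, (U : Matrix S S ℂ) x.2 s * ψ (x.1, s)
    simp only [Finset.mul_sum, mul_left_comm]

/-- The quantum walk operator `Q = T (I ⊗ U)` of the triple `(G, Σ, U)`. -/
def walk (U : Matrix.unitaryGroup S ℂ) : Module.End ℂ (State S) := shift S ∘ₗ coin U

/-- The projection `Π_no^B` onto the closed span of the basis vectors outside `B`. -/
def projNo (B : Set (G × S)) : State S →ₗ[ℂ] State S where
  toFun ψ := ⟨Bᶜ.indicator fun x => ψ x, memℓp_projNo B ψ⟩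
  map_add' φ ψ := by
    ext x
    exact congrFun (Set.indicator_add' Bᶜ (fun x => φ x) (fun x => ψ x)) x
  map_smul' c ψ := by
    ext x
    exact congrFun (Set.indicator_const_smul Bᶜ c (fun x => ψ x)) x

/-- The absorbing quantum walk operator `Π_no^B Q` of the quadruple `(G, Σ, U, B)`. -/
def absorbingWalk (U : Matrix.unitaryGroup S ℂ) (B : Set (G × S)) : Module.End ℂ (State S) :=
  projNo B ∘ₗ walk U

/-- The probability that the walk `(G, Σ, U, B)` started in `ψ` is eventually absorbed in `B₀`
before it is absorbed in `B \ B₀`: the sum over `t ≥ 1` (here `t = k + 1`) and `b ∈ B₀` of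
`|⟨b| Q (Π_no^B Q)^(t-1) |ψ⟩|²`. -/
def absorptionProb (U : Matrix.unitaryGroup S ℂ) (B B₀ : Set (G × S)) (ψ : State S) : ℝ≥0∞ :=
  ∑' k : ℕ, ∑' b : B₀, ‖inner ℂ (ket b.1) (walk U ((absorbingWalk U B ^ k) ψ))‖ₑ ^ 2

end General

/-- The set `C₁ = {1, -1}` of directions of the two-state walk on `ℤ`. -/
def C₁ : Finset ℤ := {1, -1}

/-- The internal state `|R⟩`, moving one step to the right. -/
def R : C₁ := ⟨1, by simp [C₁]⟩

/-- The internal state `|L⟩`, moving one step to the left. -/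
def L : C₁ := ⟨-1, by simp [C₁]⟩

/-- `P_n^{(m)}(α, β)`: the probability that the walk `(ℤ, C₁, U, {0, n})`, initialized in
`|m⟩(α|R⟩ + β|L⟩)`, is eventually absorbed at `|0⟩` before being absorbed at `|n⟩`. -/
def P (U : Matrix.unitaryGroup C₁ ℂ) (n m : ℕ) (α β : ℂ) : ℝ≥0∞ :=
  absorptionProb U {x | x.1 = 0 ∨ x.1 = (n : ℤ)} {x | x.1 = 0}
    (α • ket ((m : ℤ), R) + β • ket ((m : ℤ), L))

end

end QuantumWalk

/-! The absorption probability is a conserved quantity in disguise. Let W be the absorbing walk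
restricted to the interior 1, …, n-1. If a Hermitian form K satisfies the Stein equation K(ψ) -
K(Wψ) = (probability leaving through 0 in one step), then summing over time telescopes to K(ψ₀) -
lim K(Wᵗψ₀). The limit vanishes because every interior amplitude decays, so the answer is K(ψ₀).

Write |b| = tanh ξ, so that |a| = 1/cosh ξ. After phases are gauged away (`exists_phases`) the coin
is a real rotation, and K has an explicit kernel built from sinh and cosh. In the bulk the Stein
equation is a set of addition-formula identities (`stein_RR`, `stein_LL`, `stein_RL`). Summation by
parts leaves only one boundary term, the outflow at 0 (`IsBoxWalk.absorptionForm_succ`).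

For |m⟩|R⟩ only one diagonal entry survives (`P_one_zero`), giving (tanh ξ / 2) · (sinh((n-1)ξ) +
sinh((n+1-2m)ξ)) / cosh((n-1)ξ). As n - m → ∞ the two quotients tend to 1 and to lim exp(-2(m-1)ξ).
For fixed m the latter is ((1-|b|)/(1+|b|))^(m-1); along a ray it is 0. -/

namespace QuantumWalk

noncomputable section

/-! ### The hyperbolic kernel and its boundary values -/

/-- Right-right entry of the form that solves the Stein equation of the walk on `{1, …, n - 1}`. -/
def kerRR (ξ : ℝ) (n x y : ℤ) : ℝ :=
  if Even (x + y) then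
    Real.tanh ξ / 2 * ((Real.sinh ((n - 1 - |x - y| : ℤ) * ξ) +
      Real.sinh ((n + 1 - x - y : ℤ) * ξ)) / Real.cosh ((n - 1 : ℤ) * ξ))
  else 0

/-- Right-left entry of the form that solves the Stein equation. -/
def kerRL (ξ : ℝ) (n x y : ℤ) : ℝ :=
  if Even (x + y) then
    Real.tanh ξ / 2 * ((if x ≤ y then
      -(Real.cosh ((n - 2 + x - y : ℤ) * ξ) + Real.cosh ((n - x - y : ℤ) * ξ))
    else Real.cosh ((n - x + y : ℤ) * ξ) - Real.cosh ((n - x - y : ℤ) * ξ)) /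
      Real.cosh ((n - 1 : ℤ) * ξ))
  else 0

/-- Left-left entry of the form that solves the Stein equation. -/
def kerLL (ξ : ℝ) (n x y : ℤ) : ℝ :=
  (if x = y then 1 else 0) - kerRR ξ n (n - x) (n - y)

theorem kerRR_comm (ξ : ℝ) (n x y : ℤ) : kerRR ξ n x y = kerRR ξ n y x := by
  simp only [kerRR, add_comm x y, abs_sub_comm x y, sub_right_comm _ x y]

theorem kerLL_comm (ξ : ℝ) (n x y : ℤ) : kerLL ξ n x y = kerLL ξ n y x := by
  simp only [kerLL, kerRR_comm ξ n (n - x), eq_comm (a := x)]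

/-- At y = n the two sinh arguments are opposite. This and the next boundary values remove every
boundary term of the later summation by parts except the one carried by `kerLL_zero_zero`, which is
the outflow at 0. -/
theorem kerRR_right_end (ξ : ℝ) {n x : ℤ} (hx : x ≤ n) : kerRR ξ n x n = 0 := by
  have h : (n - 1 - |x - n| : ℤ) = -(n + 1 - x - n) := by
    rw [abs_of_nonpos (by omega)]; ring
  rw [kerRR, h, Int.cast_neg, neg_mul, Real.sinh_neg]
  simp

theorem kerRL_right_end (ξ : ℝ) {n y : ℤ} (hy : y < n) : kerRL ξ n n y = 0 := by
  simp [kerRL, not_le.2 hy]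

theorem kerRL_left_end (ξ : ℝ) {n x : ℤ} (hx : 0 < x) : kerRL ξ n x 0 = 0 := by
  simp [kerRL, not_le.2 hx]

theorem kerLL_left_end (ξ : ℝ) {n x : ℤ} (hx : 0 < x) : kerLL ξ n x 0 = 0 := by
  simp [kerLL, hx.ne', kerRR_right_end ξ (show n - x ≤ n by omega)]

theorem kerLL_zero_zero (ξ : ℝ) (n : ℤ) : kerLL ξ n 0 0 = 1 := by
  simp [kerLL, kerRR_right_end ξ le_rfl]

theorem kerRR_of_le (ξ : ℝ) {n x y : ℤ} (h : Even (x + y)) (hxy : x ≤ y) :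
    kerRR ξ n x y = Real.tanh ξ / 2 * ((Real.sinh ((n - 1 + x - y) * ξ) +
      Real.sinh ((n + 1 - x - y) * ξ)) / Real.cosh ((n - 1) * ξ)) := by
  have h1 : (n - 1 - |x - y| : ℤ) = n - 1 + x - y := by rw [abs_of_nonpos (by omega)]; ring
  rw [kerRR, if_pos h, h1]
  push_cast; rfl

theorem kerRL_of_le (ξ : ℝ) {n x y : ℤ} (h : Even (x + y)) (hxy : x ≤ y) :
    kerRL ξ n x y = Real.tanh ξ / 2 * (-(Real.cosh ((n - 2 + x - y) * ξ) +
      Real.cosh ((n - x - y) * ξ)) / Real.cosh ((n - 1) * ξ)) := by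
  rw [kerRL, if_pos h, if_pos hxy]
  push_cast; rfl

theorem kerRL_of_lt (ξ : ℝ) {n x y : ℤ} (h : Even (x + y)) (hxy : y < x) :
    kerRL ξ n x y = Real.tanh ξ / 2 * ((Real.cosh ((n - x + y) * ξ) -
      Real.cosh ((n - x - y) * ξ)) / Real.cosh ((n - 1) * ξ)) := by
  rw [kerRL, if_pos h, if_neg hxy.not_ge]
  push_cast; rfl

theorem kerLL_of_le (ξ : ℝ) {n x y : ℤ} (h : Even (x + y)) (hxy : x ≤ y) :
    kerLL ξ n x y = (if x = y then 1 else 0) -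
      Real.tanh ξ / 2 * ((Real.sinh ((n - 1 + x - y) * ξ) -
      Real.sinh ((n - 1 - x - y) * ξ)) / Real.cosh ((n - 1) * ξ)) := by
  have h2 : Even (n - y + (n - x)) := by
    rw [show n - y + (n - x) = 2 * (n - y) - (x + y) + 2 * y by ring]
    exact ((even_two_mul _).sub h).add (even_two_mul _)
  rw [kerLL, kerRR_comm, kerRR_of_le ξ h2 (by omega), sub_eq_add_neg (Real.sinh _),
    ← Real.sinh_neg]
  push_cast
  congr 6 <;> ring_nf

/-- Each step changes the position by ±1, so the form can be taken to decouple the two parity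
classes of sites. -/
theorem ker_of_odd (ξ : ℝ) {n x y : ℤ} (h : ¬ Even (x + y)) :
    kerRR ξ n x y = 0 ∧ kerRL ξ n x y = 0 ∧ kerLL ξ n x y = 0 := by
  have h2 : ¬ Even (n - x + (n - y)) := by
    rw [show n - x + (n - y) = 2 * n - (x + y) by ring, Int.even_sub]
    simpa using h
  have h3 : x ≠ y := by rintro rfl; exact h ⟨x, rfl⟩
  exact ⟨if_neg h, if_neg h, by simp [kerLL, h3, kerRR, h2]⟩

theorem even_shift {x y u v : ℤ} (h : Even (x + y)) (k : ℤ) (h' : u + v = x + y + 2 * k) :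
    Even (u + v) := h' ▸ h.add (even_two_mul k)

theorem odd_shift {x y u v : ℤ} (h : ¬ Even (x + y)) (k : ℤ) (h' : u + v = x + y + 2 * k) :
    ¬ Even (u + v) := fun hu => h (even_shift hu (-k) (by linarith))

/-- The values of the shifted kernels above the diagonal, in the variables
`P = (n - 1 + x - y) ξ` and `Q = (n - x - y) ξ`. -/
theorem ker_of_lt (ξ : ℝ) {n x y : ℤ} (h : Even (x + y)) (hxy : x < y) {P Q k : ℝ}
    (hP : P = (n - 1 + x - y) * ξ) (hQ : Q = (n - x - y) * ξ)
    (hk : k = Real.tanh ξ / 2 / Real.cosh ((n - 1) * ξ)) :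
    kerRR ξ n x y = k * (Real.sinh P + Real.sinh (Q + ξ)) ∧
    kerRR ξ n (x + 1) (y + 1) = k * (Real.sinh P + Real.sinh (Q - ξ)) ∧
    kerLL ξ n x y = -(k * (Real.sinh P - Real.sinh (Q - ξ))) ∧
    kerLL ξ n (x - 1) (y - 1) = -(k * (Real.sinh P - Real.sinh (Q + ξ))) ∧
    kerRL ξ n x y = -(k * (Real.cosh (P - ξ) + Real.cosh Q)) ∧
    kerRL ξ n y x = k * (Real.cosh (P + ξ) - Real.cosh Q) ∧
    kerRL ξ n (x + 1) (y - 1) = -(k * (Real.cosh (P + ξ) + Real.cosh Q)) ∧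
    kerRL ξ n (y + 1) (x - 1) = k * (Real.cosh (P - ξ) - Real.cosh Q) := by
  -- Equal parity forces a gap of at least 2, so moving both arguments inward does not cross to the
  -- other branch of `kerRL`.
  have hlt : x + 1 ≤ y - 1 := by
    obtain ⟨r, hr⟩ := h
    omega
  subst hP hQ hk
  rw [kerRR_of_le ξ h hxy.le,
    kerRR_of_le ξ (even_shift h 1 (by ring) : Even (x + 1 + (y + 1))) (by omega),
    kerLL_of_le ξ h hxy.le,
    kerLL_of_le ξ (even_shift h (-1) (by ring) : Even (x - 1 + (y - 1))) (by omega),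
    kerRL_of_le ξ h hxy.le,
    kerRL_of_lt ξ (even_shift h 0 (by ring) : Even (y + x)) hxy,
    kerRL_of_le ξ (even_shift h 0 (by ring) : Even (x + 1 + (y - 1))) hlt,
    kerRL_of_lt ξ (even_shift h 0 (by ring) : Even (y + 1 + (x - 1))) (by omega),
    if_neg hxy.ne, if_neg (by omega)]
  push_cast
  refine ⟨?_, ?_, ?_, ?_, ?_, ?_, ?_, ?_⟩ <;> ring_nf

/-- The values of the shifted kernels on the diagonal. -/
theorem ker_diag (ξ : ℝ) (n x : ℤ) {P Q k : ℝ}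
    (hP : P = (n - 1) * ξ) (hQ : Q = (n - 2 * x) * ξ)
    (hk : k = Real.tanh ξ / 2 / Real.cosh P) :
    kerRR ξ n x x = k * (Real.sinh P + Real.sinh (Q + ξ)) ∧
    kerRR ξ n (x + 1) (x + 1) = k * (Real.sinh P + Real.sinh (Q - ξ)) ∧
    kerLL ξ n x x = 1 - k * (Real.sinh P - Real.sinh (Q - ξ)) ∧
    kerLL ξ n (x - 1) (x - 1) = 1 - k * (Real.sinh P - Real.sinh (Q + ξ)) ∧
    kerRL ξ n x x = -(k * (Real.cosh (P - ξ) + Real.cosh Q)) ∧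
    kerRL ξ n (x + 1) (x - 1) = k * (Real.cosh (P - ξ) - Real.cosh Q) := by
  subst hP hQ hk
  rw [kerRR_of_le ξ ⟨x, rfl⟩ le_rfl, kerRR_of_le ξ ⟨x + 1, rfl⟩ le_rfl,
    kerLL_of_le ξ ⟨x, rfl⟩ le_rfl, kerLL_of_le ξ ⟨x - 1, rfl⟩ le_rfl,
    kerRL_of_le ξ ⟨x, rfl⟩ le_rfl,
    kerRL_of_lt ξ (⟨x, by ring⟩ : Even (x + 1 + (x - 1))) (by omega), if_pos rfl, if_pos rfl]
  push_cast
  refine ⟨?_, ?_, ?_, ?_, ?_, ?_⟩ <;> ring_nf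

/-! ### The Stein equation in the bulk -/

theorem one_eq_of_cosh (ξ : ℝ) {α β : ℝ} (hα : α = (Real.cosh ξ)⁻¹) (hβ : β = Real.tanh ξ) :
    α ^ 2 + β ^ 2 = 1 ∧ Real.sinh ξ = β * Real.cosh ξ ∧ α * Real.cosh ξ = 1 := by
  have h1 : α * Real.cosh ξ = 1 := by rw [hα, inv_mul_cancel₀ (Real.cosh_pos ξ).ne']
  have h2 : Real.sinh ξ = β * Real.cosh ξ := by
    rw [hβ, Real.tanh_eq_sinh_div_cosh, div_mul_cancel₀ _ (Real.cosh_pos ξ).ne']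
  refine ⟨?_, h2, h1⟩
  have h3 := Real.cosh_sq ξ
  rw [h2] at h3
  linear_combination -α ^ 2 * h3 - (α * Real.cosh ξ + 1) * (β ^ 2 - 1) * h1

/-- This compares the coefficients of conj(u x) · u y before and after one step: the coin sends (u,
v) to (αu + βv, -βu + αv), then the two components move right and left. `stein_LL` and `stein_RL` do
the same for the other coefficients. -/
theorem stein_RR_of_le (ξ : ℝ) {α β : ℝ} (hα : α = (Real.cosh ξ)⁻¹) (hβ : β = Real.tanh ξ)
    {n x y : ℤ} (hxy : x ≤ y) :
    α ^ 2 * kerRR ξ n (x + 1) (y + 1) -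
      α * β * (kerRL ξ n (x + 1) (y - 1) + kerRL ξ n (y + 1) (x - 1)) +
      β ^ 2 * kerLL ξ n (x - 1) (y - 1) = kerRR ξ n x y := by
  by_cases h : Even (x + y)
  swap
  · rw [(ker_of_odd ξ h).1,
      (ker_of_odd ξ (odd_shift h 1 (by ring) : ¬ Even (x + 1 + (y + 1)))).1,
      (ker_of_odd ξ (odd_shift h 0 (by ring) : ¬ Even (x + 1 + (y - 1)))).2.1,
      (ker_of_odd ξ (odd_shift h 0 (by ring) : ¬ Even (y + 1 + (x - 1)))).2.1,
      (ker_of_odd ξ (odd_shift h (-1) (by ring) : ¬ Even (x - 1 + (y - 1)))).2.2]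
    ring
  obtain ⟨h1, h2, h3⟩ := one_eq_of_cosh ξ hα hβ
  rcases hxy.lt_or_eq with hlt | rfl
  · obtain ⟨e1, e2, -, e4, -, -, e7, e8⟩ := ker_of_lt ξ (n := n) h hlt rfl rfl rfl
    rw [e1, e2, e4, e7, e8]
    simp only [Real.sinh_add, Real.sinh_sub, Real.cosh_add, Real.cosh_sub, h2]
    set sP := Real.sinh ((n - 1 + x - y) * ξ)
    set cP := Real.cosh ((n - 1 + x - y) * ξ)
    set sQ := Real.sinh ((n - x - y) * ξ)
    set cQ := Real.cosh ((n - x - y) * ξ)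
    set c := Real.cosh ξ
    set k := Real.tanh ξ / 2 / Real.cosh ((n - 1) * ξ)
    linear_combination k * (sP + sQ * c + β * c * cQ) * h1 + k * (2 * β ^ 2 * sP - 2 * α * β * cQ) * h3
  · obtain ⟨e1, e2, -, e4, -, e6⟩ := ker_diag ξ n x rfl rfl rfl
    rw [e1, e2, e4, e6]
    simp only [Real.sinh_add, Real.sinh_sub, Real.cosh_sub, h2]
    set sP := Real.sinh ((n - 1) * ξ)
    set cP := Real.cosh ((n - 1) * ξ)
    set sQ := Real.sinh ((n - 2 * x) * ξ)
    set cQ := Real.cosh ((n - 2 * x) * ξ)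
    set c := Real.cosh ξ
    -- Only the diagonal fixes the normalisation of the kernel. There both `kerRL` terms fall in the
    -- branch y < x, and the resulting jump must cancel the Kronecker delta in `kerLL`.
    have hk : Real.tanh ξ / 2 / cP * cP = β / 2 := by
      rw [hβ, div_mul_cancel₀ _ (Real.cosh_pos _).ne']
    set k := Real.tanh ξ / 2 / cP
    linear_combination k * (sP + sQ * c + β * c * cQ) * h1 + k * (2 * β ^ 2 * sP - 2 * α * β * cQ) * h3 +
      (-2 * α * β * c * hk - β ^ 2 * h3)

theorem stein_RR (ξ : ℝ) {α β : ℝ} (hα : α = (Real.cosh ξ)⁻¹) (hβ : β = Real.tanh ξ)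
    (n x y : ℤ) :
    α ^ 2 * kerRR ξ n (x + 1) (y + 1) -
      α * β * (kerRL ξ n (x + 1) (y - 1) + kerRL ξ n (y + 1) (x - 1)) +
      β ^ 2 * kerLL ξ n (x - 1) (y - 1) = kerRR ξ n x y := by
  rcases le_total x y with h | h
  · exact stein_RR_of_le ξ hα hβ h
  · rw [kerRR_comm ξ n x y, ← stein_RR_of_le ξ hα hβ h, kerRR_comm ξ n (x + 1),
      kerLL_comm ξ n (x - 1), add_comm (kerRL ξ n (x + 1) (y - 1))]

theorem stein_LL_of_le (ξ : ℝ) {α β : ℝ} (hα : α = (Real.cosh ξ)⁻¹) (hβ : β = Real.tanh ξ)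
    {n x y : ℤ} (hxy : x ≤ y) :
    β ^ 2 * kerRR ξ n (x + 1) (y + 1) +
      α * β * (kerRL ξ n (x + 1) (y - 1) + kerRL ξ n (y + 1) (x - 1)) +
      α ^ 2 * kerLL ξ n (x - 1) (y - 1) = kerLL ξ n x y := by
  by_cases h : Even (x + y)
  swap
  · rw [(ker_of_odd ξ h).2.2,
      (ker_of_odd ξ (odd_shift h 1 (by ring) : ¬ Even (x + 1 + (y + 1)))).1,
      (ker_of_odd ξ (odd_shift h 0 (by ring) : ¬ Even (x + 1 + (y - 1)))).2.1,
      (ker_of_odd ξ (odd_shift h 0 (by ring) : ¬ Even (y + 1 + (x - 1)))).2.1,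
      (ker_of_odd ξ (odd_shift h (-1) (by ring) : ¬ Even (x - 1 + (y - 1)))).2.2]
    ring
  obtain ⟨h1, h2, h3⟩ := one_eq_of_cosh ξ hα hβ
  rcases hxy.lt_or_eq with hlt | rfl
  · obtain ⟨-, e2, e3, e4, -, -, e7, e8⟩ := ker_of_lt ξ (n := n) h hlt rfl rfl rfl
    rw [e2, e3, e4, e7, e8]
    simp only [Real.sinh_add, Real.sinh_sub, Real.cosh_add, Real.cosh_sub, h2]
    set sP := Real.sinh ((n - 1 + x - y) * ξ)
    set cP := Real.cosh ((n - 1 + x - y) * ξ)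
    set sQ := Real.sinh ((n - x - y) * ξ)
    set cQ := Real.cosh ((n - x - y) * ξ)
    set c := Real.cosh ξ
    set k := Real.tanh ξ / 2 / Real.cosh ((n - 1) * ξ)
    linear_combination k * (-sP + sQ * c - β * c * cQ) * h1 + k * (-2 * β ^ 2 * sP + 2 * α * β * cQ) * h3
  · obtain ⟨-, e2, e3, e4, -, e6⟩ := ker_diag ξ n x rfl rfl rfl
    rw [e2, e3, e4, e6]
    simp only [Real.sinh_add, Real.sinh_sub, Real.cosh_sub, h2]
    set sP := Real.sinh ((n - 1) * ξ)
    set cP := Real.cosh ((n - 1) * ξ)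
    set sQ := Real.sinh ((n - 2 * x) * ξ)
    set cQ := Real.cosh ((n - 2 * x) * ξ)
    set c := Real.cosh ξ
    have hk : Real.tanh ξ / 2 / cP * cP = β / 2 := by
      rw [hβ, div_mul_cancel₀ _ (Real.cosh_pos _).ne']
    set k := Real.tanh ξ / 2 / cP
    linear_combination k * (-sP + sQ * c - β * c * cQ) * h1 + k * (-2 * β ^ 2 * sP + 2 * α * β * cQ) * h3 +
      (2 * α * β * c * hk + β ^ 2 * h3 + h1)

theorem stein_LL (ξ : ℝ) {α β : ℝ} (hα : α = (Real.cosh ξ)⁻¹) (hβ : β = Real.tanh ξ)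
    (n x y : ℤ) :
    β ^ 2 * kerRR ξ n (x + 1) (y + 1) +
      α * β * (kerRL ξ n (x + 1) (y - 1) + kerRL ξ n (y + 1) (x - 1)) +
      α ^ 2 * kerLL ξ n (x - 1) (y - 1) = kerLL ξ n x y := by
  rcases le_total x y with h | h
  · exact stein_LL_of_le ξ hα hβ h
  · rw [kerLL_comm ξ n x y, ← stein_LL_of_le ξ hα hβ h, kerRR_comm ξ n (x + 1),
      kerLL_comm ξ n (x - 1), add_comm (kerRL ξ n (x + 1) (y - 1))]

theorem stein_RL (ξ : ℝ) {α β : ℝ} (hα : α = (Real.cosh ξ)⁻¹) (hβ : β = Real.tanh ξ)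
    (n x y : ℤ) :
    α * β * kerRR ξ n (x + 1) (y + 1) + α ^ 2 * kerRL ξ n (x + 1) (y - 1) -
      β ^ 2 * kerRL ξ n (y + 1) (x - 1) - α * β * kerLL ξ n (x - 1) (y - 1) = kerRL ξ n x y := by
  by_cases h : Even (x + y)
  swap
  · rw [(ker_of_odd ξ h).2.1,
      (ker_of_odd ξ (odd_shift h 1 (by ring) : ¬ Even (x + 1 + (y + 1)))).1,
      (ker_of_odd ξ (odd_shift h 0 (by ring) : ¬ Even (x + 1 + (y - 1)))).2.1,
      (ker_of_odd ξ (odd_shift h 0 (by ring) : ¬ Even (y + 1 + (x - 1)))).2.1,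
      (ker_of_odd ξ (odd_shift h (-1) (by ring) : ¬ Even (x - 1 + (y - 1)))).2.2]
    ring
  obtain ⟨h1, h2, h3⟩ := one_eq_of_cosh ξ hα hβ
  -- `kerRL` is not symmetric, so the region y < x needs its own computation.
  rcases lt_trichotomy x y with hlt | rfl | hlt
  · obtain ⟨-, e2, -, e4, e5, -, e7, e8⟩ := ker_of_lt ξ (n := n) h hlt rfl rfl rfl
    rw [e2, e4, e5, e7, e8]
    simp only [Real.sinh_add, Real.sinh_sub, Real.cosh_add, Real.cosh_sub, h2]
    set sP := Real.sinh ((n - 1 + x - y) * ξ)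
    set cP := Real.cosh ((n - 1 + x - y) * ξ)
    set sQ := Real.sinh ((n - x - y) * ξ)
    set cQ := Real.cosh ((n - x - y) * ξ)
    set c := Real.cosh ξ
    set k := Real.tanh ξ / 2 / Real.cosh ((n - 1) * ξ)
    linear_combination k * (β * c * sP - c * cP - cQ) * h1 + k * (-2 * α * β * sP - 2 * β ^ 2 * cQ) * h3
  · obtain ⟨-, e2, -, e4, e5, e6⟩ := ker_diag ξ n x rfl rfl rfl
    rw [e2, e4, e5, e6]
    simp only [Real.sinh_add, Real.sinh_sub, Real.cosh_sub, h2]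
    set sP := Real.sinh ((n - 1) * ξ)
    set cP := Real.cosh ((n - 1) * ξ)
    set sQ := Real.sinh ((n - 2 * x) * ξ)
    set cQ := Real.cosh ((n - 2 * x) * ξ)
    set c := Real.cosh ξ
    have hk : Real.tanh ξ / 2 / cP * cP = β / 2 := by
      rw [hβ, div_mul_cancel₀ _ (Real.cosh_pos _).ne']
    set k := Real.tanh ξ / 2 / cP
    linear_combination k * (β * c * sP - c * cP - cQ) * h1 + k * (-2 * α * β * sP - 2 * β ^ 2 * cQ) * h3 +
      (2 * α ^ 2 * c * hk + α * β * h3)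
  · rw [kerRR_comm, kerLL_comm]
    obtain ⟨-, e2, -, e4, -, e6, e7, e8⟩ :=
      ker_of_lt ξ (n := n) (even_shift h 0 (by ring) : Even (y + x)) hlt rfl rfl rfl
    rw [e2, e4, e6, e7, e8]
    simp only [Real.sinh_add, Real.sinh_sub, Real.cosh_add, Real.cosh_sub, h2]
    set sP := Real.sinh ((n - 1 + y - x) * ξ)
    set cP := Real.cosh ((n - 1 + y - x) * ξ)
    set sQ := Real.sinh ((n - y - x) * ξ)
    set cQ := Real.cosh ((n - y - x) * ξ)
    set c := Real.cosh ξ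
    set k := Real.tanh ξ / 2 / Real.cosh ((n - 1) * ξ)
    linear_combination k * (β * c * sP + c * cP - cQ) * h1 + k * (-2 * α * β * sP - 2 * β ^ 2 * cQ) * h3

/-! ### Summation by parts on the box -/

theorem sum_Icc_shift {n : ℤ} (hn : 1 ≤ n) (g : ℤ → ℂ) :
    ∑ x ∈ Finset.Icc 1 (n - 1), g (x + 1) = ∑ x ∈ Finset.Icc 1 (n - 1), g x + g n - g 1 := by
  induction n, hn using Int.leInduction with
  | base => simp
  | succ n hn ih =>
    have h : Finset.Icc 1 (n + 1 - 1) = insert n (Finset.Icc 1 (n - 1)) := by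
      ext; simp only [Finset.mem_Icc, Finset.mem_insert]; omega
    rw [h, Finset.sum_insert (by simp), Finset.sum_insert (by simp), ih]
    ring

theorem sum_mul_shift_sub {n : ℤ} (hn : 1 ≤ n) (F f : ℤ → ℂ) (hf : f 0 = 0) :
    ∑ x ∈ Finset.Icc 1 (n - 1), F x * f (x - 1) =
      ∑ x ∈ Finset.Icc 1 (n - 1), F (x + 1) * f x - F n * f (n - 1) := by
  have h := sum_Icc_shift hn fun x => F x * f (x - 1)
  simp only [add_sub_cancel_right, sub_self, hf, mul_zero, sub_zero] at h
  rw [h]; ring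

theorem sum_mul_shift_add {n : ℤ} (hn : 1 ≤ n) (F f : ℤ → ℂ) (hf : f n = 0) :
    ∑ x ∈ Finset.Icc 1 (n - 1), F x * f (x + 1) =
      ∑ x ∈ Finset.Icc 1 (n - 1), F (x - 1) * f x - F 0 * f 1 := by
  have h := sum_Icc_shift hn fun x => F (x - 1) * f x
  simp only [add_sub_cancel_right, sub_self, hf, mul_zero, add_zero] at h
  exact h

/-- The amplitudes `u` and `v` of the right- and left-moving states of the absorbing walk on
`{1, …, n - 1}` with coin `[α, β; -β, α]`. -/
structure IsBoxWalk (α β : ℝ) (n : ℤ) (u v : ℕ → ℤ → ℂ) : Prop where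
  u_zero : ∀ t, u t 0 = 0
  v_zero : ∀ t, v t 0 = 0
  u_last : ∀ t, u t n = 0
  v_last : ∀ t, v t n = 0
  u_succ : ∀ t x, x ∈ Finset.Icc 1 (n - 1) → u (t + 1) x = α * u t (x - 1) + β * v t (x - 1)
  v_succ : ∀ t x, x ∈ Finset.Icc 1 (n - 1) → v (t + 1) x = -β * u t (x + 1) + α * v t (x + 1)

/-- The Hermitian form that solves the Stein equation. -/
def absorptionForm (ξ : ℝ) (n : ℤ) (u v : ℤ → ℂ) : ℂ :=
  ∑ x ∈ Finset.Icc 1 (n - 1), ∑ y ∈ Finset.Icc 1 (n - 1),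
    (kerRR ξ n x y * (star (u x) * u y) + kerRL ξ n x y * (star (u x) * v y) +
      kerRL ξ n y x * (star (v x) * u y) + kerLL ξ n x y * (star (v x) * v y))

theorem sum_kerRR_shift (ξ : ℝ) {n : ℤ} (hn : 1 ≤ n) {f g : ℤ → ℂ} (hf : f 0 = 0) (hg : g 0 = 0) :
    ∑ x ∈ Finset.Icc 1 (n - 1), ∑ y ∈ Finset.Icc 1 (n - 1),
        (kerRR ξ n x y : ℂ) * (f (x - 1) * g (y - 1)) =
      ∑ x ∈ Finset.Icc 1 (n - 1), ∑ y ∈ Finset.Icc 1 (n - 1),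
        (kerRR ξ n (x + 1) (y + 1) : ℂ) * (f x * g y) := by
  have h1 : ∀ x ∈ Finset.Icc 1 (n - 1), ∑ y ∈ Finset.Icc 1 (n - 1),
      (kerRR ξ n x y : ℂ) * (f (x - 1) * g (y - 1)) =
      (∑ y ∈ Finset.Icc 1 (n - 1), kerRR ξ n x (y + 1) * g y) * f (x - 1) := by
    intro x hx
    rw [Finset.mem_Icc] at hx
    have h := sum_mul_shift_sub hn (fun y => (kerRR ξ n x y : ℂ)) g hg
    rw [kerRR_right_end ξ (by omega : x ≤ n), Complex.ofReal_zero, zero_mul, sub_zero] at h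
    rw [← h, Finset.sum_mul]
    exact Finset.sum_congr rfl fun y _ => by ring
  rw [Finset.sum_congr rfl h1, sum_mul_shift_sub hn
    (fun x => ∑ y ∈ Finset.Icc 1 (n - 1), (kerRR ξ n x (y + 1) : ℂ) * g y) f hf,
    Finset.sum_eq_zero (s := Finset.Icc 1 (n - 1)) (f := fun y => (kerRR ξ n n (y + 1) : ℂ) * g y),
    zero_mul, sub_zero]
  · refine Finset.sum_congr rfl fun x _ => ?_
    rw [Finset.sum_mul]
    exact Finset.sum_congr rfl fun y _ => by ring
  · intro y hy
    rw [Finset.mem_Icc] at hy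
    rw [kerRR_comm, kerRR_right_end ξ (by omega), Complex.ofReal_zero, zero_mul]

theorem sum_kerRL_shift (ξ : ℝ) {n : ℤ} (hn : 1 ≤ n) {f g : ℤ → ℂ} (hf : f 0 = 0) (hg : g n = 0) :
    ∑ x ∈ Finset.Icc 1 (n - 1), ∑ y ∈ Finset.Icc 1 (n - 1),
        (kerRL ξ n x y : ℂ) * (f (x - 1) * g (y + 1)) =
      ∑ x ∈ Finset.Icc 1 (n - 1), ∑ y ∈ Finset.Icc 1 (n - 1),
        (kerRL ξ n (x + 1) (y - 1) : ℂ) * (f x * g y) := by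
  have h1 : ∀ x ∈ Finset.Icc 1 (n - 1), ∑ y ∈ Finset.Icc 1 (n - 1),
      (kerRL ξ n x y : ℂ) * (f (x - 1) * g (y + 1)) =
      (∑ y ∈ Finset.Icc 1 (n - 1), kerRL ξ n x (y - 1) * g y) * f (x - 1) := by
    intro x hx
    rw [Finset.mem_Icc] at hx
    have h := sum_mul_shift_add hn (fun y => (kerRL ξ n x y : ℂ)) g hg
    rw [kerRL_left_end ξ (by omega : 0 < x), Complex.ofReal_zero, zero_mul, sub_zero] at h
    rw [← h, Finset.sum_mul]
    exact Finset.sum_congr rfl fun y _ => by ring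
  rw [Finset.sum_congr rfl h1, sum_mul_shift_sub hn
    (fun x => ∑ y ∈ Finset.Icc 1 (n - 1), (kerRL ξ n x (y - 1) : ℂ) * g y) f hf,
    Finset.sum_eq_zero (s := Finset.Icc 1 (n - 1)) (f := fun y => (kerRL ξ n n (y - 1) : ℂ) * g y),
    zero_mul, sub_zero]
  · refine Finset.sum_congr rfl fun x _ => ?_
    rw [Finset.sum_mul]
    exact Finset.sum_congr rfl fun y _ => by ring
  · intro y hy
    rw [Finset.mem_Icc] at hy
    rw [kerRL_right_end ξ (by omega), Complex.ofReal_zero, zero_mul]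

theorem sum_kerLL_shift (ξ : ℝ) {n : ℤ} (hn : 1 ≤ n) {f g : ℤ → ℂ} (hf : f n = 0) (hg : g n = 0) :
    ∑ x ∈ Finset.Icc 1 (n - 1), ∑ y ∈ Finset.Icc 1 (n - 1),
        (kerLL ξ n x y : ℂ) * (f (x + 1) * g (y + 1)) =
      ∑ x ∈ Finset.Icc 1 (n - 1), ∑ y ∈ Finset.Icc 1 (n - 1),
        (kerLL ξ n (x - 1) (y - 1) : ℂ) * (f x * g y) - f 1 * g 1 := by
  have h1 : ∀ x ∈ Finset.Icc 1 (n - 1), ∑ y ∈ Finset.Icc 1 (n - 1),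
      (kerLL ξ n x y : ℂ) * (f (x + 1) * g (y + 1)) =
      (∑ y ∈ Finset.Icc 1 (n - 1), kerLL ξ n x (y - 1) * g y) * f (x + 1) := by
    intro x hx
    rw [Finset.mem_Icc] at hx
    have h := sum_mul_shift_add hn (fun y => (kerLL ξ n x y : ℂ)) g hg
    rw [kerLL_left_end ξ (by omega : 0 < x), Complex.ofReal_zero, zero_mul, sub_zero] at h
    rw [← h, Finset.sum_mul]
    exact Finset.sum_congr rfl fun y _ => by ring
  have h2 : ∑ y ∈ Finset.Icc 1 (n - 1), (kerLL ξ n 0 (y - 1) : ℂ) * g y = g 1 := by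
    rcases hn.lt_or_eq with hn | rfl
    · rw [Finset.sum_eq_single 1]
      · simp [kerLL_zero_zero]
      · intro y hy hy1
        rw [Finset.mem_Icc] at hy
        rw [kerLL_comm, kerLL_left_end ξ (by omega), Complex.ofReal_zero, zero_mul]
      · intro h
        exact absurd (Finset.mem_Icc.2 ⟨le_rfl, by omega⟩) h
    -- For n = 1 the box is empty and the site 1 is the right barrier, so both sides vanish.
    · simp [hg]
  rw [Finset.sum_congr rfl h1, sum_mul_shift_add hn
    (fun x => ∑ y ∈ Finset.Icc 1 (n - 1), (kerLL ξ n x (y - 1) : ℂ) * g y) f hf, h2]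
  congr 1
  · refine Finset.sum_congr rfl fun x _ => ?_
    rw [Finset.sum_mul]
    exact Finset.sum_congr rfl fun y _ => by ring
  · ring

/-! ### Telescoping and decay for the walk in the box -/

namespace IsBoxWalk

variable {α β : ℝ} {n : ℤ} {u v : ℕ → ℤ → ℂ}

/-- Shifting the summation indices moves the step from the amplitudes to the kernel, where the bulk
Stein identities apply. The only boundary term left is the squared norm of the amplitude leaving
site 1 to the left. -/
theorem absorptionForm_succ (H : IsBoxWalk α β n u v) {ξ : ℝ} (hα : α = (Real.cosh ξ)⁻¹)
    (hβ : β = Real.tanh ξ) (hn : 1 ≤ n) (t : ℕ) :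
    absorptionForm ξ n (u (t + 1)) (v (t + 1)) =
      absorptionForm ξ n (u t) (v t) - ((‖-β * u t 1 + α * v t 1‖ ^ 2 : ℝ) : ℂ) := by
  set h : ℤ → ℂ := fun x => α * u t x + β * v t x with hh
  set l : ℤ → ℂ := fun x => -β * u t x + α * v t x with hl
  have h0 : h 0 = 0 := by simp [hh, H.u_zero, H.v_zero]
  have ln : l n = 0 := by simp [hl, H.u_last, H.v_last]
  have hnext : absorptionForm ξ n (u (t + 1)) (v (t + 1)) =
      ∑ x ∈ Finset.Icc 1 (n - 1), ∑ y ∈ Finset.Icc 1 (n - 1),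
        (kerRR ξ n x y * (star (h (x - 1)) * h (y - 1)) +
          kerRL ξ n x y * (star (h (x - 1)) * l (y + 1)) +
          kerRL ξ n y x * (star (l (x + 1)) * h (y - 1)) +
          kerLL ξ n x y * (star (l (x + 1)) * l (y + 1))) := by
    refine Finset.sum_congr rfl fun x hx => Finset.sum_congr rfl fun y hy => ?_
    rw [H.u_succ t x hx, H.u_succ t y hy, H.v_succ t x hx, H.v_succ t y hy]
  have hLR : ∑ x ∈ Finset.Icc 1 (n - 1), ∑ y ∈ Finset.Icc 1 (n - 1),
        (kerRL ξ n y x : ℂ) * (star (l (x + 1)) * h (y - 1)) =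
      ∑ x ∈ Finset.Icc 1 (n - 1), ∑ y ∈ Finset.Icc 1 (n - 1),
        (kerRL ξ n (y + 1) (x - 1) : ℂ) * (star (l x) * h y) := by
    -- The left-right block is the transpose of the right-left one.
    rw [Finset.sum_comm]
    conv_rhs => rw [Finset.sum_comm]
    have e := sum_kerRL_shift ξ hn (f := h) (g := fun x => star (l x)) h0 (by simp [ln])
    simpa only [mul_comm (h _)] using e
  have hout : ((‖l 1‖ ^ 2 : ℝ) : ℂ) = star (l 1) * l 1 := by
    rw [Complex.star_def, Complex.conj_mul']; push_cast; rfl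
  change _ = _ - ((‖l 1‖ ^ 2 : ℝ) : ℂ)
  rw [hnext, hout]
  simp only [Finset.sum_add_distrib]
  rw [sum_kerRR_shift ξ hn (f := fun x => star (h x)) (g := h) (by simp [h0]) h0,
    sum_kerRL_shift ξ hn (f := fun x => star (h x)) (g := l) (by simp [h0]) ln, hLR,
    sum_kerLL_shift ξ hn (f := fun x => star (l x)) (g := l) (by simp [ln]) ln, ← add_sub_assoc]
  congr 1
  simp only [← Finset.sum_add_distrib, absorptionForm]
  refine Finset.sum_congr rfl fun x _ => Finset.sum_congr rfl fun y _ => ?_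
  have eRR := congrArg ((↑) : ℝ → ℂ) (stein_RR ξ hα hβ n x y)
  have eLL := congrArg ((↑) : ℝ → ℂ) (stein_LL ξ hα hβ n x y)
  have eRL := congrArg ((↑) : ℝ → ℂ) (stein_RL ξ hα hβ n x y)
  have eLR := congrArg ((↑) : ℝ → ℂ) (stein_RL ξ hα hβ n y x)
  rw [kerRR_comm ξ n (y + 1), kerLL_comm ξ n (y - 1)] at eLR
  push_cast at eRR eLL eRL eLR
  simp only [hh, hl, star_add, star_mul', star_neg, Complex.star_def, Complex.conj_ofReal]
  linear_combination (starRingEnd ℂ (u t x) * u t y) * eRR +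
    (starRingEnd ℂ (u t x) * v t y) * eRL + (starRingEnd ℂ (v t x) * u t y) * eLR +
    (starRingEnd ℂ (v t x) * v t y) * eLL

/-- The coin is a rotation and the shift only loses mass at the two ends; the loss at n is
discarded. -/
theorem norm_sq_succ (H : IsBoxWalk α β n u v) (hαβ : α ^ 2 + β ^ 2 = 1) (hn : 1 ≤ n) (t : ℕ) :
    ∑ x ∈ Finset.Icc 1 (n - 1), (‖u (t + 1) x‖ ^ 2 + ‖v (t + 1) x‖ ^ 2) +
      ‖-β * u t 1 + α * v t 1‖ ^ 2 ≤
      ∑ x ∈ Finset.Icc 1 (n - 1), (‖u t x‖ ^ 2 + ‖v t x‖ ^ 2) := by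
  set h : ℤ → ℂ := fun x => α * u t x + β * v t x with hh
  set l : ℤ → ℂ := fun x => -β * u t x + α * v t x with hl
  have h0 : h 0 = 0 := by simp [hh, H.u_zero, H.v_zero]
  have ln : l n = 0 := by simp [hl, H.u_last, H.v_last]
  have e1 := sum_mul_shift_sub hn (fun _ => 1) (fun x => ((‖h x‖ ^ 2 : ℝ) : ℂ)) (by simp [h0])
  have e2 := sum_mul_shift_add hn (fun _ => 1) (fun x => ((‖l x‖ ^ 2 : ℝ) : ℂ)) (by simp [ln])
  simp only [one_mul] at e1 e2
  norm_cast at e1 e2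
  have e3 : ∀ x ∈ Finset.Icc 1 (n - 1), ‖u (t + 1) x‖ ^ 2 + ‖v (t + 1) x‖ ^ 2 =
      ‖h (x - 1)‖ ^ 2 + ‖l (x + 1)‖ ^ 2 := by
    intro x hx
    rw [H.u_succ t x hx, H.v_succ t x hx]
  have e4 : ∀ x, ‖u t x‖ ^ 2 + ‖v t x‖ ^ 2 = ‖h x‖ ^ 2 + ‖l x‖ ^ 2 := by
    intro x
    simp only [hh, hl, Complex.sq_norm, Complex.normSq_apply, Complex.add_re, Complex.add_im,
      Complex.mul_re, Complex.mul_im, Complex.neg_re, Complex.neg_im, Complex.ofReal_re,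
      Complex.ofReal_im]
    linear_combination (-((u t x).re ^ 2 + (u t x).im ^ 2 + (v t x).re ^ 2 + (v t x).im ^ 2)) * hαβ
  rw [Finset.sum_congr rfl e3, Finset.sum_congr rfl fun x _ => e4 x, Finset.sum_add_distrib,
    Finset.sum_add_distrib, e1, e2]
  change _ + ‖l 1‖ ^ 2 ≤ _
  have : 0 ≤ ‖h (n - 1)‖ ^ 2 := by positivity
  linarith

theorem tendsto_out (H : IsBoxWalk α β n u v) (hαβ : α ^ 2 + β ^ 2 = 1) (hn : 1 ≤ n) :
    Tendsto (fun t => -β * u t 1 + α * v t 1) atTop (𝓝 0) := by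
  have hs : Summable fun t => ‖-β * u t 1 + α * v t 1‖ ^ 2 := by
    refine summable_of_sum_range_le
      (c := ∑ x ∈ Finset.Icc 1 (n - 1), (‖u 0 x‖ ^ 2 + ‖v 0 x‖ ^ 2))
      (fun _ => by positivity) fun T => ?_
    have : ∑ t ∈ Finset.range T, ‖-β * u t 1 + α * v t 1‖ ^ 2 +
        ∑ x ∈ Finset.Icc 1 (n - 1), (‖u T x‖ ^ 2 + ‖v T x‖ ^ 2) ≤
        ∑ x ∈ Finset.Icc 1 (n - 1), (‖u 0 x‖ ^ 2 + ‖v 0 x‖ ^ 2) := by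
      induction T with
      | zero => simp
      | succ T ih =>
        rw [Finset.sum_range_succ]
        linarith [H.norm_sq_succ hαβ hn T]
    have h0 : 0 ≤ ∑ x ∈ Finset.Icc 1 (n - 1), (‖u T x‖ ^ 2 + ‖v T x‖ ^ 2) := by positivity
    linarith
  rw [tendsto_zero_iff_norm_tendsto_zero]
  have := hs.tendsto_atTop_zero.sqrt
  simpa [Real.sqrt_sq] using this

/-- An observability argument: a vanishing outflow at 0 propagates inward. If u and v vanish
asymptotically at x, the right-moving output makes u vanish at x + 1. The vanishing left-moving
output at x + 1, with α ≠ 0, then gives v there. Since v at x + 1 is the left-moving output of x + 2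
one step earlier, the induction continues. -/
theorem tendsto_zero (H : IsBoxWalk α β n u v) (hα : α ≠ 0) (hαβ : α ^ 2 + β ^ 2 = 1)
    (hn : 1 ≤ n) {x : ℤ} (hx0 : 0 ≤ x) (hxn : x ≤ n - 1) :
    Tendsto (fun t => u t x) atTop (𝓝 0) ∧ Tendsto (fun t => v t x) atTop (𝓝 0) ∧
      Tendsto (fun t => -β * u t (x + 1) + α * v t (x + 1)) atTop (𝓝 0) := by
  have hα' : (α : ℂ) ≠ 0 := by exact_mod_cast hα
  induction x, hx0 using Int.leInduction with
  | base =>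
    simp only [H.u_zero, H.v_zero, tendsto_const_nhds, true_and, zero_add]
    exact H.tendsto_out hαβ hn
  | succ x hx ih =>
    obtain ⟨hu, hv, hl⟩ := ih (by omega)
    have hmem : x + 1 ∈ Finset.Icc 1 (n - 1) := Finset.mem_Icc.2 ⟨by omega, hxn⟩
    have hu' : Tendsto (fun t => u t (x + 1)) atTop (𝓝 0) := by
      rw [← tendsto_add_atTop_iff_nat 1]
      simp only [H.u_succ _ _ hmem, add_sub_cancel_right]
      have h : Tendsto (fun t => (α : ℂ) * u t x + β * v t x) atTop
          (𝓝 ((α : ℂ) * 0 + β * 0)) := (hu.const_mul _).add (hv.const_mul _)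
      simpa using h
    have hv' : Tendsto (fun t => v t (x + 1)) atTop (𝓝 0) := by
      have h : Tendsto (fun t => (α : ℂ)⁻¹ * (-β * u t (x + 1) + α * v t (x + 1) +
          β * u t (x + 1))) atTop (𝓝 ((α : ℂ)⁻¹ * (0 + β * 0))) :=
        (hl.add (hu'.const_mul (β : ℂ))).const_mul _
      simp only [mul_zero, add_zero] at h
      refine h.congr fun t => ?_
      field_simp
      ring
    refine ⟨hu', hv', ?_⟩
    rw [← tendsto_add_atTop_iff_nat 1] at hv'
    simpa only [H.v_succ _ _ hmem] using hv'

theorem tendsto_absorptionForm (H : IsBoxWalk α β n u v) (hα : α ≠ 0) (hαβ : α ^ 2 + β ^ 2 = 1)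
    (hn : 1 ≤ n) (ξ : ℝ) : Tendsto (fun t => absorptionForm ξ n (u t) (v t)) atTop (𝓝 0) := by
  have h : ∀ {f g : ℕ → ℂ} (k : ℂ), Tendsto f atTop (𝓝 0) → Tendsto g atTop (𝓝 0) →
      Tendsto (fun t => k * (star (f t) * g t)) atTop (𝓝 0) := fun k hf hg => by
    simpa using (hf.star.mul hg).const_mul k
  refine Finset.sum_const_zero (ι := ℤ) (s := Finset.Icc 1 (n - 1)) (M := ℂ) ▸
    tendsto_finsetSum _ fun x hx => ?_
  refine Finset.sum_const_zero (ι := ℤ) (s := Finset.Icc 1 (n - 1)) (M := ℂ) ▸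
    tendsto_finsetSum _ fun y hy => ?_
  rw [Finset.mem_Icc] at hx hy
  obtain ⟨ux, vx, -⟩ := H.tendsto_zero hα hαβ hn (by omega : 0 ≤ x) hx.2
  obtain ⟨uy, vy, -⟩ := H.tendsto_zero hα hαβ hn (by omega : 0 ≤ y) hy.2
  simpa using (((h (kerRR ξ n x y) ux uy).add (h (kerRL ξ n x y) ux vy)).add
    (h (kerRL ξ n y x) vx uy)).add (h (kerLL ξ n x y) vx vy)

/-- The probability that the walk is absorbed at `0` is the value of the form at the initial
state. -/
theorem hasSum_out (H : IsBoxWalk α β n u v) {ξ : ℝ} (hα : α = (Real.cosh ξ)⁻¹)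
    (hβ : β = Real.tanh ξ) (hn : 1 ≤ n) :
    HasSum (fun t => ‖-β * u t 1 + α * v t 1‖ ^ 2) (absorptionForm ξ n (u 0) (v 0)).re := by
  obtain ⟨hαβ, -, h3⟩ := one_eq_of_cosh ξ hα hβ
  have hα0 : α ≠ 0 := left_ne_zero_of_mul_eq_one h3
  rw [hasSum_iff_tendsto_nat_of_nonneg fun _ => by positivity]
  have hpart : ∀ T, ∑ t ∈ Finset.range T, ‖-β * u t 1 + α * v t 1‖ ^ 2 =
      (absorptionForm ξ n (u 0) (v 0) - absorptionForm ξ n (u T) (v T)).re := by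
    intro T
    induction T with
    | zero => simp
    | succ T ih =>
      rw [Finset.sum_range_succ, ih, H.absorptionForm_succ hα hβ hn T]
      simp only [Complex.sub_re, Complex.ofReal_re]
      ring
  simp only [hpart]
  have h := (H.tendsto_absorptionForm hα0 hαβ hn ξ).const_sub (absorptionForm ξ n (u 0) (v 0))
  rw [sub_zero] at h
  exact (Complex.continuous_re.tendsto _).comp h

end IsBoxWalk

/-! ### Reduction to a real coin and the exact probability -/

theorem sum_C₁ {M : Type*} [AddCommMonoid M] (f : C₁ → M) : ∑ s, f s = f R + f L := by
  have h : (Finset.univ : Finset C₁) = {R, L} := by decide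
  rw [h, Finset.sum_pair (by decide)]

theorem R_ne_L : R ≠ L := by decide

/-- Up to phases, a two-state coin is `[α, β; -β, α]` with `α, β ≥ 0`. -/
theorem exists_phases (U : Matrix.unitaryGroup C₁ ℂ)
    (h0 : (U : Matrix C₁ C₁ ℂ) R R ≠ 0) :
    ∃ w₁ w₂ w₃ : ℂ, ‖w₁‖ = 1 ∧ ‖w₂‖ = 1 ∧ ‖w₃‖ = 1 ∧
      w₁ * w₂ * (U : Matrix C₁ C₁ ℂ) R R = ‖(U : Matrix C₁ C₁ ℂ) R R‖ ∧
      w₁ * w₂ * (U : Matrix C₁ C₁ ℂ) R L = ‖(U : Matrix C₁ C₁ ℂ) R L‖ * w₃ ∧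
      w₁ * w₃ * (U : Matrix C₁ C₁ ℂ) L R = -‖(U : Matrix C₁ C₁ ℂ) R L‖ * w₂ ∧
      w₁ * (U : Matrix C₁ C₁ ℂ) L L = ‖(U : Matrix C₁ C₁ ℂ) R R‖ * w₂ := by
  have hU := Matrix.mem_unitaryGroup_iff.1 U.2
  have hRR := congrFun (congrFun hU R) R
  have hRL := congrFun (congrFun hU R) L
  have hLL := congrFun (congrFun hU L) L
  simp only [Matrix.mul_apply, sum_C₁, Matrix.star_apply, Matrix.one_apply_eq,
    Matrix.one_apply_ne R_ne_L, Complex.star_def] at hRR hRL hLL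
  generalize (U : Matrix C₁ C₁ ℂ) R R = a at *
  generalize (U : Matrix C₁ C₁ ℂ) R L = b at *
  generalize (U : Matrix C₁ C₁ ℂ) L R = c at *
  generalize (U : Matrix C₁ C₁ ℂ) L L = d at *
  have hnorm : ‖d‖ = ‖a‖ := by
    have e1 : ‖a‖ ^ 2 + ‖b‖ ^ 2 = 1 := by
      rw [Complex.mul_conj', Complex.mul_conj'] at hRR; exact_mod_cast hRR
    have e2 : ‖c‖ ^ 2 + ‖d‖ ^ 2 = 1 := by
      rw [Complex.mul_conj', Complex.mul_conj'] at hLL; exact_mod_cast hLL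
    have e3 : ‖a‖ * ‖c‖ = ‖b‖ * ‖d‖ := by
      have := congrArg norm (eq_neg_of_add_eq_zero_left hRL)
      simpa using this
    have e4 : ‖d‖ ^ 2 = ‖a‖ ^ 2 := by
      have : (‖a‖ * ‖c‖) ^ 2 = (‖b‖ * ‖d‖) ^ 2 := by rw [e3]
      linear_combination -this - (‖d‖ ^ 2) * e1 + (‖a‖ ^ 2) * e2
    exact (sq_eq_sq₀ (norm_nonneg _) (norm_nonneg _)).1 e4
  have hunit : ∀ z : ℂ, ∃ s : ℝ, z = ‖z‖ * Complex.exp (s * Complex.I) := fun z =>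
    ⟨z.arg, (Complex.norm_mul_exp_arg_mul_I z).symm⟩
  obtain ⟨p, hp⟩ := hunit a
  obtain ⟨q, hq⟩ := hunit b
  obtain ⟨r, hr⟩ := hunit d
  rw [hnorm] at hr
  have hna : (‖a‖ : ℂ) ≠ 0 := by simpa using h0
  generalize ‖a‖ = A at *
  generalize ‖b‖ = B at *
  have hconj : ∀ s : ℝ, starRingEnd ℂ (Complex.exp (s * Complex.I)) =
      Complex.exp (((-s : ℝ) : ℂ) * Complex.I) := by
    intro s
    rw [← Complex.exp_conj]
    simp
  -- Orthogonality of the rows determines c, since A ≠ 0.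
  have hc : c = -B * Complex.exp (((p + r - q : ℝ) : ℂ) * Complex.I) := by
    have e := congrArg (starRingEnd ℂ) hRL
    rw [hp, hq, hr] at e
    simp only [map_add, map_mul, Complex.conj_conj, Complex.conj_ofReal, hconj, map_zero, neg_neg] at e
    have e' : (A : ℂ) * Complex.exp (((-p : ℝ) : ℂ) * Complex.I) *
        (c + B * Complex.exp (((p + r - q : ℝ) : ℂ) * Complex.I)) = 0 := by
      rw [← e, show ((p + r - q : ℝ) : ℂ) * Complex.I =
        (p : ℂ) * Complex.I + (((-q : ℝ) : ℂ) * Complex.I + (r : ℂ) * Complex.I) by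
          push_cast; ring, Complex.exp_add, Complex.exp_add]
      have : Complex.exp (((-p : ℝ) : ℂ) * Complex.I) * Complex.exp (p * Complex.I) = 1 := by
        rw [← Complex.exp_add]; simp
      linear_combination (A * B * Complex.exp (((-q : ℝ) : ℂ) * Complex.I) *
        Complex.exp (r * Complex.I)) * this
    rcases mul_eq_zero.1 e' with e' | e'
    · simp [hna] at e'
    · linear_combination e'
  -- With p, q, r the arguments of a, b, d: w₁ is a phase per time step, w₂ a phase per site, and w₃
  -- the relative phase of |L⟩ against |R⟩.
  refine ⟨Complex.exp ((-(p + r) / 2 : ℝ) * Complex.I),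
    Complex.exp ((-(p - r) / 2 : ℝ) * Complex.I), Complex.exp ((q - p : ℝ) * Complex.I),
    Complex.norm_exp_ofReal_mul_I _, Complex.norm_exp_ofReal_mul_I _,
    Complex.norm_exp_ofReal_mul_I _, ?_, ?_, ?_, ?_⟩
  · rw [hp, ← Complex.exp_add, mul_left_comm, ← Complex.exp_add]
    convert mul_one (A : ℂ)
    rw [← Complex.exp_zero]
    congr 1; push_cast; ring
  · rw [hq, ← Complex.exp_add, mul_left_comm, ← Complex.exp_add]
    congr 2; push_cast; ring
  · rw [hc, ← Complex.exp_add, mul_left_comm, ← Complex.exp_add]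
    congr 2; push_cast; ring
  · rw [hr, mul_left_comm, ← Complex.exp_add]
    congr 2; push_cast; ring

theorem walk_apply_R (U : Matrix.unitaryGroup C₁ ℂ) (ψ : State C₁) (x : ℤ) :
    walk U ψ (x, R) = (U : Matrix C₁ C₁ ℂ) R R * ψ (x - 1, R) +
      (U : Matrix C₁ C₁ ℂ) R L * ψ (x - 1, L) := by
  change ∑ s : C₁, (U : Matrix C₁ C₁ ℂ) R s * ψ (-1 + x, s) = _
  rw [sum_C₁, neg_add_eq_sub]

theorem walk_apply_L (U : Matrix.unitaryGroup C₁ ℂ) (ψ : State C₁) (x : ℤ) :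
    walk U ψ (x, L) = (U : Matrix C₁ C₁ ℂ) L R * ψ (x + 1, R) +
      (U : Matrix C₁ C₁ ℂ) L L * ψ (x + 1, L) := by
  change ∑ s : C₁, (U : Matrix C₁ C₁ ℂ) L s * ψ (- -1 + x, s) = _
  rw [sum_C₁, neg_neg, add_comm 1 x]

theorem absorbingWalk_apply_of_mem {U : Matrix.unitaryGroup C₁ ℂ} {B : Set (ℤ × C₁)}
    {x : ℤ × C₁} (h : x ∈ B) (ψ : State C₁) : absorbingWalk U B ψ x = 0 :=
  Set.indicator_of_notMem (Set.notMem_compl_iff.2 h) _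

theorem absorbingWalk_apply_of_notMem {U : Matrix.unitaryGroup C₁ ℂ} {B : Set (ℤ × C₁)}
    {x : ℤ × C₁} (h : x ∉ B) (ψ : State C₁) : absorbingWalk U B ψ x = walk U ψ x :=
  Set.indicator_of_mem h _

theorem inner_ket (x : ℤ × C₁) (ψ : State C₁) : inner ℂ (ket x) ψ = ψ x := by
  simp [ket, lp.inner_single_left]

theorem ket_self (x : ℤ × C₁) : ket x x = 1 := by
  simp [ket]

theorem ket_of_ne {x y : ℤ × C₁} (h : y ≠ x) : ket x y = 0 := by
  simp [ket, h]

/-- The exact absorption probability at the left barrier. -/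
theorem P_one_zero (U : Matrix.unitaryGroup C₁ ℂ) {ξ : ℝ}
    (hξ : ‖(U : Matrix C₁ C₁ ℂ) R L‖ = Real.tanh ξ) {n m : ℕ} (hm : 1 ≤ m) (hmn : m < n) :
    P U n m 1 0 = ENNReal.ofReal (kerRR ξ n m m) := by
  have hRR : ‖(U : Matrix C₁ C₁ ℂ) R R‖ ^ 2 + ‖(U : Matrix C₁ C₁ ℂ) R L‖ ^ 2 = 1 := by
    have h := congrFun (congrFun (Matrix.mem_unitaryGroup_iff.1 U.2) R) R
    simp only [Matrix.mul_apply, sum_C₁, Matrix.star_apply, Matrix.one_apply_eq,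
      Complex.star_def, Complex.mul_conj'] at h
    exact_mod_cast h
  have hα : ‖(U : Matrix C₁ C₁ ℂ) R R‖ = (Real.cosh ξ)⁻¹ := by
    rw [← sq_eq_sq₀ (norm_nonneg _) (inv_nonneg.2 (Real.cosh_pos ξ).le)]
    have := (one_eq_of_cosh ξ rfl rfl).1
    rw [hξ] at hRR
    linarith
  have h0 : (U : Matrix C₁ C₁ ℂ) R R ≠ 0 := by
    rw [← norm_ne_zero_iff, hα]
    exact (inv_pos.2 (Real.cosh_pos ξ)).ne'
  obtain ⟨w₁, w₂, w₃, n1, n2, n3, ea, eb, ec, ed⟩ := exists_phases U h0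
  have hw2 : w₂ ≠ 0 := by rw [← norm_ne_zero_iff, n2]; exact one_ne_zero
  set B : Set (ℤ × C₁) := {x | x.1 = 0 ∨ x.1 = (n : ℤ)} with hB
  set ψ : ℕ → State C₁ := fun t => (absorbingWalk U B ^ t) (ket ((m : ℤ), R)) with hψ
  have hsucc : ∀ t, ψ (t + 1) = absorbingWalk U B (ψ t) := fun t => by
    simp only [hψ, pow_succ', Module.End.mul_apply]
  have hzero : ψ 0 = ket ((m : ℤ), R) := rfl
  have hψB : ∀ t x, x ∈ B → ψ t x = 0 := by
    rintro (_ | t) x hx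
    · rw [hzero]
      refine ket_of_ne ?_
      rintro rfl
      simp only [hB, Set.mem_ofPred_eq] at hx
      omega
    · rw [hsucc, absorbingWalk_apply_of_mem hx]
  have hnotMem : ∀ {x : ℤ} (s : C₁), x ∈ Finset.Icc (1 : ℤ) (n - 1) → (x, s) ∉ B := by
    intro x s hx
    rw [Finset.mem_Icc] at hx
    simp only [hB, Set.mem_ofPred_eq]
    omega
  -- The gauge transformation by these phases preserves every modulus, hence the outflow.
  set u : ℕ → ℤ → ℂ := fun t x => w₁ ^ t * w₂ ^ x * ψ t (x, R) with hu
  set v : ℕ → ℤ → ℂ := fun t x => w₁ ^ t * w₂ ^ x * w₃ * ψ t (x, L) with hv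
  have H : IsBoxWalk ‖(U : Matrix C₁ C₁ ℂ) R R‖ ‖(U : Matrix C₁ C₁ ℂ) R L‖ n u v := by
    refine ⟨fun t => ?_, fun t => ?_, fun t => ?_, fun t => ?_, fun t x hx => ?_,
      fun t x hx => ?_⟩
    · simp only [hu, hψB t (0, R) (Or.inl rfl), mul_zero]
    · simp only [hv, hψB t (0, L) (Or.inl rfl), mul_zero]
    · simp only [hu, hψB t ((n : ℤ), R) (Or.inr rfl), mul_zero]
    · simp only [hv, hψB t ((n : ℤ), L) (Or.inr rfl), mul_zero]
    · simp only [hu, hv, hsucc, absorbingWalk_apply_of_notMem (hnotMem R hx), walk_apply_R]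
      rw [show w₂ ^ x = w₂ ^ (x - 1) * w₂ by rw [← zpow_add_one₀ hw2, sub_add_cancel]]
      linear_combination (w₁ ^ t * w₂ ^ (x - 1)) * (ψ t (x - 1, R) * ea + ψ t (x - 1, L) * eb)
    · simp only [hu, hv, hsucc, absorbingWalk_apply_of_notMem (hnotMem L hx), walk_apply_L]
      rw [zpow_add_one₀ hw2]
      linear_combination (w₁ ^ t * w₂ ^ x) * (ψ t (x + 1, R) * ec + w₃ * ψ t (x + 1, L) * ed)
  have hsum := H.hasSum_out hα hξ (by omega)
  have hform : absorptionForm ξ n (u 0) (v 0) = kerRR ξ n m m := by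
    have hv0 : ∀ x, v 0 x = 0 := fun x => by
      simp only [hv, hzero]
      rw [ket_of_ne (by simp [R_ne_L.symm]), mul_zero]
    have hu0 : ∀ x, x ≠ (m : ℤ) → u 0 x = 0 := fun x hx => by
      simp only [hu, hzero]
      rw [ket_of_ne (by simp [hx]), mul_zero]
    have hum : star (u 0 m) * u 0 m = 1 := by
      rw [Complex.star_def, Complex.conj_mul']
      simp [hu, hzero, ket_self, n2]
    have hmem : (m : ℤ) ∈ Finset.Icc 1 ((n : ℤ) - 1) := Finset.mem_Icc.2 ⟨by omega, by omega⟩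
    rw [absorptionForm, Finset.sum_eq_single_of_mem _ hmem,
      Finset.sum_eq_single_of_mem _ hmem]
    · simp only [hv0, hum]; simp
    · intro y _ hy
      simp [hv0, hu0 y hy]
    · intro x _ hx
      simp [hv0, hu0 x hx]
  have hout : ∀ t, ‖walk U (ψ t) (0, L)‖ =
      ‖-(‖(U : Matrix C₁ C₁ ℂ) R L‖ : ℂ) * u t 1 + ‖(U : Matrix C₁ C₁ ℂ) R R‖ * v t 1‖ := by
    intro t
    have : -(‖(U : Matrix C₁ C₁ ℂ) R L‖ : ℂ) * u t 1 + ‖(U : Matrix C₁ C₁ ℂ) R R‖ * v t 1 =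
        w₁ ^ t * w₁ * w₃ * walk U (ψ t) (0, L) := by
      simp only [hu, hv, walk_apply_L, zero_add, zpow_one]
      linear_combination (-w₁ ^ t) * (ψ t (1, R) * ec + w₃ * ψ t (1, L) * ed)
    rw [this]
    simp [n1, n3]
  -- Reaching |0⟩|R⟩ requires amplitude at -1, but the barrier at 0 never lets any amplitude reach
  -- the negative sites.
  have hR0 : ∀ t, walk U (ψ t) (0, R) = 0 := by
    have hneg : ∀ t (s : C₁) (x : ℤ), x < 0 → ψ t (x, s) = 0 := by
      intro t
      induction t with
      | zero =>
        intro s x hx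
        rw [hzero]
        refine ket_of_ne fun h => ?_
        have := congrArg Prod.fst h
        simp only at this
        omega
      | succ t ih =>
        intro s x hx
        have hnext : ∀ s, ψ t (x + 1, s) = 0 := fun s => by
          rcases (by omega : x + 1 < 0 ∨ x + 1 = 0) with h | h
          · exact ih s _ h
          · exact hψB t _ (Or.inl h)
        have hs : s = R ∨ s = L := by revert s; decide
        by_cases hB' : (x, s) ∈ B
        · exact hψB _ _ hB'
        · rw [hsucc, absorbingWalk_apply_of_notMem hB']
          rcases hs with rfl | rfl
          · rw [walk_apply_R, ih _ _ (by omega), ih _ _ (by omega), mul_zero, mul_zero, add_zero]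
          · rw [walk_apply_L, hnext, hnext, mul_zero, mul_zero, add_zero]
    intro t
    rw [walk_apply_R, hneg _ _ _ (by omega), hneg _ _ _ (by omega), mul_zero, mul_zero, add_zero]
  have hterm : ∀ t, ∑' b : ({x | x.1 = 0} : Set (ℤ × C₁)),
      ‖inner ℂ (ket b.1) (walk U (ψ t))‖ₑ ^ 2 = ENNReal.ofReal (‖walk U (ψ t) (0, L)‖ ^ 2) := by
    intro t
    rw [tsum_eq_single (⟨(0, L), rfl⟩ : ({x | x.1 = 0} : Set (ℤ × C₁)))]
    · rw [inner_ket, ENNReal.ofReal_pow (norm_nonneg _), ofReal_norm]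
    · rintro ⟨⟨x, s⟩, hx⟩ hne
      obtain rfl : x = 0 := hx
      have hs : s = R ∨ s = L := by revert s; decide
      rcases hs with rfl | rfl
      · rw [inner_ket, hR0]; simp
      · exact absurd rfl hne
  calc P U n m 1 0
      = ∑' t, ∑' b : ({x | x.1 = 0} : Set (ℤ × C₁)),
          ‖inner ℂ (ket b.1) (walk U (ψ t))‖ₑ ^ 2 := by
        simp only [P, absorptionProb, one_smul, zero_smul, add_zero, hψ, hB]
    _ = ∑' t, ENNReal.ofReal (‖walk U (ψ t) (0, L)‖ ^ 2) := tsum_congr hterm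
    _ = ENNReal.ofReal (kerRR ξ n m m) := by
        simp only [← hout, hform, Complex.ofReal_re] at hsum
        rw [← hsum.tsum_eq, ENNReal.ofReal_tsum_of_nonneg (fun _ => by positivity) hsum.summable]

/-! ### Asymptotics -/

/-- Multiply numerator and denominator by exp(-x): only exp(y - x) survives, over 1. -/
theorem tendsto_sinh_div_cosh {ι : Type*} {l : Filter ι} {x y : ι → ℝ} {p : ℝ}
    (hx : Tendsto x l atTop) (hp : Tendsto (fun i => Real.exp (y i - x i)) l (𝓝 p))
    (hq : Tendsto (fun i => x i + y i) l atTop) :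
    Tendsto (fun i => Real.sinh (y i) / Real.cosh (x i)) l (𝓝 p) := by
  have hq' : Tendsto (fun i => Real.exp (-(x i + y i))) l (𝓝 0) :=
    Real.tendsto_exp_neg_atTop_nhds_zero.comp hq
  have hx' : Tendsto (fun i => Real.exp (-(x i + x i))) l (𝓝 0) :=
    Real.tendsto_exp_neg_atTop_nhds_zero.comp (hx.atTop_add_atTop hx)
  have h : Tendsto (fun i => (Real.exp (y i - x i) - Real.exp (-(x i + y i))) /
      (1 + Real.exp (-(x i + x i)))) l (𝓝 ((p - 0) / (1 + 0))) :=
    (hp.sub hq').div (hx'.const_add 1) (by norm_num)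
  rw [sub_zero, add_zero, div_one] at h
  refine h.congr fun i => ?_
  have e1 : Real.exp (y i - x i) = Real.exp (-x i) * Real.exp (y i) := by
    rw [← Real.exp_add]; ring_nf
  have e2 : Real.exp (-(x i + y i)) = Real.exp (-x i) * Real.exp (-y i) := by
    rw [← Real.exp_add]; ring_nf
  have e3 : 1 + Real.exp (-(x i + x i)) =
      Real.exp (-x i) * (Real.exp (x i) + Real.exp (-x i)) := by
    rw [mul_add, ← Real.exp_add, ← Real.exp_add, neg_add_cancel, Real.exp_zero, neg_add]
  rw [e1, e2, e3, ← mul_sub, mul_div_mul_left _ _ (Real.exp_pos _).ne', Real.sinh_eq,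
    Real.cosh_eq, div_div_div_cancel_right₀ two_ne_zero]

theorem tendsto_kerRR {ι : Type*} {l : Filter ι} {ξ p : ℝ} (hξ : 0 < ξ) {n m : ι → ℕ}
    (hn : Tendsto n l atTop) (hp : Tendsto (fun i => Real.exp (-(2 * (m i - 1) * ξ))) l (𝓝 p))
    (hnm : Tendsto (fun i => (n i - m i : ℝ)) l atTop) :
    Tendsto (fun i => kerRR ξ (n i) (m i) (m i)) l (𝓝 (Real.tanh ξ / 2 * (1 + p))) := by
  have hx : Tendsto (fun i => (n i - 1 : ℝ) * ξ) l atTop :=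
    (tendsto_atTop_add_const_right l (-1) (tendsto_natCast_atTop_atTop.comp hn)).atTop_mul_const hξ
  have h1 : Tendsto (fun i => Real.sinh ((n i - 1 : ℝ) * ξ) / Real.cosh ((n i - 1 : ℝ) * ξ)) l
      (𝓝 1) :=
    tendsto_sinh_div_cosh hx (by simpa using tendsto_const_nhds) (hx.atTop_add_atTop hx)
  have h2 : Tendsto (fun i => Real.sinh ((n i + 1 - m i - m i : ℝ) * ξ) /
      Real.cosh ((n i - 1 : ℝ) * ξ)) l (𝓝 p) := by
    -- Here y - x = -2(m-1)ξ and x + y = 2(n-m)ξ.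
    refine tendsto_sinh_div_cosh hx (hp.congr fun i => ?_)
      ((hnm.atTop_mul_const (mul_pos two_pos hξ)).congr fun i => ?_)
    · congr 1; ring
    · ring
  refine ((h1.add h2).const_mul (Real.tanh ξ / 2)).congr fun i => ?_
  rw [kerRR_of_le ξ ⟨_, rfl⟩ le_rfl, add_sub_cancel_right, add_div]
  push_cast; rfl

end

end QuantumWalk

theorem theorem4p4 (U : Matrix.unitaryGroup QuantumWalk.C₁ ℂ) (b : ℂ)
    (hb : b = (U : Matrix QuantumWalk.C₁ QuantumWalk.C₁ ℂ) QuantumWalk.R QuantumWalk.L)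
    (hb1 : ‖b‖ < 1) :
    (∀ m : ℕ, 1 ≤ m →
      Tendsto (fun n : ℕ => QuantumWalk.P U n m 1 0) atTop
        (𝓝 (ENNReal.ofReal (‖b‖ / 2 * (1 + ((1 - ‖b‖) / (1 + ‖b‖)) ^ (m - 1)))))) ∧
    (∀ c : ℝ, 0 < c → c < 1 →
      ∀ n m : ℕ → ℕ, Tendsto n atTop atTop →
        Tendsto (fun k : ℕ => (m k : ℝ) / (n k : ℝ)) atTop (𝓝 c) →
        Tendsto (fun k : ℕ => QuantumWalk.P U (n k) (m k) 1 0) atTop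
          (𝓝 (ENNReal.ofReal (‖b‖ / 2)))) := by
  have hmem : ‖b‖ ∈ Set.Ioo (-1 : ℝ) 1 := ⟨by linarith [norm_nonneg b], hb1⟩
  obtain ⟨ξ, hξ0, hξ⟩ : ∃ ξ : ℝ, 0 ≤ ξ ∧ ‖b‖ = Real.tanh ξ :=
    ⟨Real.artanh ‖b‖, Real.artanh_nonneg (norm_nonneg b), (Real.tanh_artanh hmem).symm⟩
  have hlim : ∀ {n m : ℕ → ℕ} {p : ℝ}, Tendsto n atTop atTop → (∀ᶠ k in atTop, 1 ≤ m k) →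
      (0 < ξ → Tendsto (fun k => Real.exp (-(2 * (m k - 1) * ξ))) atTop (𝓝 p)) →
      Tendsto (fun k => (n k - m k : ℝ)) atTop atTop →
      Tendsto (fun k => QuantumWalk.P U (n k) (m k) 1 0) atTop
        (𝓝 (ENNReal.ofReal (‖b‖ / 2 * (1 + p)))) := by
    intro n m p hn hm hp hnm
    have h : Tendsto (fun k => QuantumWalk.kerRR ξ (n k) (m k) (m k)) atTop (𝓝 (‖b‖ / 2 * (1 + p))) := by
      rcases hξ0.lt_or_eq with hpos | rfl
      · rw [hξ]
        exact QuantumWalk.tendsto_kerRR hpos hn (hp hpos) hnm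
      -- When b = 0, ξ = 0 and the factor tanh ξ kills the kernel; the exponential need not tend to
      -- p in this case.
      · simp [hξ, QuantumWalk.kerRR]
    refine (ENNReal.tendsto_ofReal h).congr' ?_
    filter_upwards [hm, hnm.eventually_gt_atTop 0] with k h1 h2
    exact (QuantumWalk.P_one_zero U (hb ▸ hξ) h1 (by exact_mod_cast sub_pos.1 h2)).symm
  refine ⟨fun m hm => ?_, fun c hc0 hc1 n m hn hc => ?_⟩
  · have hexp : Real.exp (-(2 * ((m : ℝ) - 1) * ξ)) = ((1 - ‖b‖) / (1 + ‖b‖)) ^ (m - 1) := by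
      have h1 : (1 - ‖b‖) / (1 + ‖b‖) = Real.exp (-(2 * ξ)) := by
        rw [div_eq_iff (by linarith [norm_nonneg b]), hξ, Real.tanh_eq]
        have := Real.exp_pos ξ
        rw [show -(2 * ξ) = -ξ + -ξ by ring, Real.exp_add, Real.exp_neg]
        field_simp
        ring
      rw [h1, ← Real.exp_nat_mul, Nat.cast_sub hm]
      congr 1; push_cast; ring
    rw [← hexp]
    exact hlim (m := fun _ => m) tendsto_id (Eventually.of_forall fun _ => hm)
      (fun _ => tendsto_const_nhds)
      (tendsto_atTop_add_const_right _ _ tendsto_natCast_atTop_atTop)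
  · have hn' : Tendsto (fun k => (n k : ℝ)) atTop atTop := tendsto_natCast_atTop_atTop.comp hn
    have hn0 : ∀ᶠ k in atTop, (n k : ℝ) ≠ 0 := hn'.eventually_ne_atTop 0
    have hm' : Tendsto (fun k => (m k : ℝ)) atTop atTop := by
      refine (hc.pos_mul_atTop hc0 hn').congr' ?_
      filter_upwards [hn0] with k hk
      exact div_mul_cancel₀ _ hk
    -- Both m and n - m are asymptotically positive multiples of n, namely c and 1 - c times it.
    have hnm : Tendsto (fun k => (n k - m k : ℝ)) atTop atTop := by
      refine ((hc.const_sub 1).pos_mul_atTop (sub_pos.2 hc1) hn').congr' ?_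
      filter_upwards [hn0] with k hk
      field_simp
    have hfin := hlim (p := 0) hn ((tendsto_natCast_atTop_iff.1 hm').eventually_ge_atTop 1)
      (fun hpos => Real.tendsto_exp_neg_atTop_nhds_zero.comp
        (((tendsto_atTop_add_const_right _ (-1) hm').const_mul_atTop two_pos).atTop_mul_const
          hpos)) hnm
    simpa using hfin
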